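/- Let $p=(p_1,\dots,p_m)$ be a probability vector with all $p_i>0$ that is not the uniform vector $(1/m,\dots,1/m)$, let $\nu_{1n},\dots,\nu_{mn}$ be the cell frequencies among the first $n$ of a sequence of i.i.d. observations with distribution $p$ on $\{1,\dots,m\}$, and let $Y_n\in\mathbb{R}^m$ be the vector with coordinates $$Y_{in}=\frac{\nu_{in}-np_i}{\sqrt{np_i}},\qquad i=1,\dots,m.$$ Put $\sqrt p=(\sqrt{p_1},\dots,\sqrt{p_m})^T$, $\mathbb{I}=(1,\dots,1)^T$, $r=\mathbb{I}/\sqrt m$, $\langle a,b\rangle=\sum_i a_ib_i$, and $$Z_n=T_p(Y_n),\qquad T_p(y)=y-\langle y,r\rangle\,\frac{1}{1-\langle\sqrt p,r\rangle}\,(r-\sqrt p).$$ Let $X=(X_1,\dots,X_m)^T$ have independent $N(0,1)$ coordinates. Then: 1. As $n\to\infty$, $Z_n$ converges in distribution to $Z=X-\langle X,r\rangle r=X-\frac1m\langle X,\mathbb{I}\rangle\mathbb{I}$. 2. Every statistic of $Z_n$ is asymptotically distribution free: if $S$ is a Borel map from $\mathbb{R}^m$ to a (pseudo)metric space such that $S$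 is almost surely continuous at $Z$ (in particular, if $S$ is continuous), then $S(Z_n)$ converges in distribution to $S(Z)$. Thus $S(Z_n)$ has a limit distribution that is the same for all $p$ as above. 3. The transformation of $Y_n$ to $Z_n$ is one-to-one: for $n\ge1$ the vector $Y_n$ always lies in the hyperplane $\{y:\langle y,\sqrt p\rangle=0\}$, and $T_p$ maps this hyperplane bijectively onto the hyperplane $\{z:\langle z,r\rangle=0\}$. -/

import Mathlib

open MeasureTheory ProbabilityTheory Filter Topology
open scoped RealInnerProductSpace

universe u

namespace PearsonComponents

/-- The cell frequency `ν_{in}`: the number of the first `n` observations that fall in cell `i`. -/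
def freq {m : ℕ} {Ω : Type*} (ξ : ℕ → Ω → Fin m) (n : ℕ) (ω : Ω) (i : Fin m) : ℕ :=
  ((Finset.range n).filter (fun k => ξ k ω = i)).card

/-- The vector `Y_n` of components of Pearson's chi-square statistic. -/
noncomputable def Y {m : ℕ} {Ω : Type*} (p : Fin m → ℝ) (ξ : ℕ → Ω → Fin m) (n : ℕ) (ω : Ω) :
    EuclideanSpace ℝ (Fin m) :=
  WithLp.toLp 2 (fun i => ((freq ξ n ω i : ℝ) - n * p i) / √(n * p i))

/-- The vector `√p = (√p₁, …, √pₘ)`. -/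
noncomputable def sqrtVec {m : ℕ} (p : Fin m → ℝ) : EuclideanSpace ℝ (Fin m) :=
  WithLp.toLp 2 (fun i => √(p i))

/-- The vector `𝕀 = (1, …, 1)`. -/
def ones (m : ℕ) : EuclideanSpace ℝ (Fin m) :=
  WithLp.toLp 2 (fun _ => 1)

/-- The diagonal vector `r` with all coordinates `1 / √m`. -/
noncomputable def diag (m : ℕ) : EuclideanSpace ℝ (Fin m) :=
  WithLp.toLp 2 (fun _ => 1 / √(m : ℝ))

/-- The transformation `y ↦ y - ⟨y, r⟩ (1 / (1 - ⟨√p, r⟩)) (r - √p)`.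
The denominator is nonzero for every probability vector `p` other than the uniform one. -/
noncomputable def transform {m : ℕ} (p : Fin m → ℝ) (y : EuclideanSpace ℝ (Fin m)) :
    EuclideanSpace ℝ (Fin m) :=
  y - (⟪y, diag m⟫ * (1 / (1 - ⟪sqrtVec p, diag m⟫))) • (diag m - sqrtVec p)

/-- The transformed vector `Z_n`. -/
noncomputable def Z {m : ℕ} {Ω : Type*} (p : Fin m → ℝ) (ξ : ℕ → Ω → Fin m) (n : ℕ) (ω : Ω) :
    EuclideanSpace ℝ (Fin m) :=
  transform p (Y p ξ n ω)

/-- The projection `x - (1/m) ⟨x, 𝕀⟩ 𝕀`. -/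
noncomputable def centre {m : ℕ} (x : EuclideanSpace ℝ (Fin m)) : EuclideanSpace ℝ (Fin m) :=
  x - ((1 / (m : ℝ)) * ⟪x, ones m⟫) • ones m

/-- Discrete distributions on `m` cells to which the transformation applies: all probabilities are
positive, they add up to one, and they are not all equal (so that `√p ≠ r`). -/
structure IsAdmissible {m : ℕ} (p : Fin m → ℝ) : Prop where
  pos : ∀ i, 0 < p i
  sum_eq_one : ∑ i, p i = 1
  not_uniform : ∃ i, p i ≠ 1 / (m : ℝ)

/-- `ξ 0, ξ 1, …` are independent observations, each with distribution `p`. -/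
structure IsSample {m : ℕ} {Ω : Type*} [MeasurableSpace Ω] (P : Measure Ω) (p : Fin m → ℝ)
    (ξ : ℕ → Ω → Fin m) : Prop where
  measurable : ∀ k, Measurable (ξ k)
  indep : iIndepFun ξ P
  law : ∀ k i, P.real {ω | ξ k ω = i} = p i

/-- The statistic `S(Z_n)` is asymptotically distribution free: it has a limit distribution, and
this is one and the same law `ν` for all underlying distributions `p` on the `m` cells. -/
def AsymptoticallyDistributionFree {m : ℕ} {F : Type*} [TopologicalSpace F] [MeasurableSpace F]
    [OpensMeasurableSpace F] (S : EuclideanSpace ℝ (Fin m) → F) : Prop :=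
  ∃ (ν : Measure F) (_ : IsProbabilityMeasure ν),
    ∀ p : Fin m → ℝ, IsAdmissible p →
      ∀ (Ω : Type u) [MeasurableSpace Ω] (P : Measure Ω) [IsProbabilityMeasure P]
        (ξ : ℕ → Ω → Fin m), IsSample P p ξ →
          TendstoInDistribution (fun n ω => S (Z p ξ n ω)) atTop (fun s : F => s) (fun _ => P) ν

end PearsonComponents

/-! On the hyperplane orthogonal to `√p`, `T_p` agrees with the reflection that interchanges the
unit vectors `r` and `√p`, so it carries the covariance `I - √p √pᵀ` of `Y_n` to `I - r rᵀ`, which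
is free of `p`.

By Lévy's continuity theorem only the projections `⟪Z_n, t⟫ = ⟪Y_n, u⟫` matter, with `u` the adjoint
of `T_p` at `t`. They are normalised sums of i.i.d. centred scores (`inner_Y`), so the
one-dimensional central limit theorem applies, with variance `‖u‖² - ⟪√p, u⟫²`. This equals `‖t‖² -
⟪r, t⟫² = ‖centre t‖²` (`norm_sq_swapMapAdjoint_sub`), the variance of `⟪centre X, t⟫`. Statistics
follow by the mapping theorem; bijectivity holds because exchanging `r` and `√p` inverts the map. -/

namespace MeasureTheory

/-- **Mapping theorem**: convergence in distribution is preserved by measurable maps that are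
almost surely continuous at the limit. -/
theorem TendstoInDistribution.comp_of_ae_continuousAt {ι E F Ω' : Type*} {Ω : ι → Type*}
    {m : ∀ i, MeasurableSpace (Ω i)} {μ : (i : ι) → Measure (Ω i)}
    [∀ i, IsProbabilityMeasure (μ i)] {m' : MeasurableSpace Ω'} {μ' : Measure Ω'}
    [IsProbabilityMeasure μ'] [PseudoMetricSpace E] [MeasurableSpace E] [BorelSpace E]
    [PseudoMetricSpace F] [MeasurableSpace F] [BorelSpace F]
    {X : (i : ι) → Ω i → E} {Z : Ω' → E} {l : Filter ι} [l.IsCountablyGenerated]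
    (h : TendstoInDistribution X l Z μ μ') {S : E → F} (hS : Measurable S)
    (hc : ∀ᵐ ω ∂μ', ContinuousAt S (Z ω)) :
    TendstoInDistribution (fun i ω => S (X i ω)) l (fun ω => S (Z ω)) μ μ' where
  forall_aemeasurable i := hS.comp_aemeasurable (h.forall_aemeasurable i)
  aemeasurable_limit := hS.comp_aemeasurable h.aemeasurable_limit
  tendsto := by
    have hSX : ∀ i, AEMeasurable (fun ω => S (X i ω)) (μ i) := fun i =>
      hS.comp_aemeasurable (h.forall_aemeasurable i)
    have hSZ : AEMeasurable (fun ω => S (Z ω)) μ' := hS.comp_aemeasurable h.aemeasurable_limit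
    refine tendsto_of_forall_isClosed_limsup_le' fun C hC => ?_
    have hlim := ProbabilityMeasure.limsup_measure_closed_le_of_tendsto h.tendsto
      (isClosed_closure (s := S ⁻¹' C))
    have hX : ∀ i, (μ i).map (fun ω => S (X i ω)) C = (μ i).map (X i) (S ⁻¹' C) := fun i => by
      rw [Measure.map_apply_of_aemeasurable (hSX i) hC.measurableSet,
        Measure.map_apply_of_aemeasurable (h.forall_aemeasurable i) (hS hC.measurableSet)]
      rfl
    simp only [ProbabilityMeasure.coe_mk, hX] at hlim ⊢
    -- `S ⁻¹' C` need not be closed, but a point of its closure outside it is a discontinuity of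
    -- `S`, and the limit almost surely avoids these.
    calc limsup (fun i => (μ i).map (X i) (S ⁻¹' C)) l
        ≤ limsup (fun i => (μ i).map (X i) (closure (S ⁻¹' C))) l :=
          limsup_le_limsup (.of_forall fun i => measure_mono subset_closure)
      _ ≤ μ'.map Z (closure (S ⁻¹' C)) := hlim
      _ ≤ μ'.map (fun ω => S (Z ω)) C := by
          rw [Measure.map_apply_of_aemeasurable h.aemeasurable_limit
            isClosed_closure.measurableSet, Measure.map_apply_of_aemeasurable hSZ hC.measurableSet]
          refine measure_mono_ae ?_
          filter_upwards [hc] with ω hω hmem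
          exact hC.closure_subset_iff.2 (Set.image_preimage_subset S C)
            (hω.continuousWithinAt.mem_closure_image hmem)

end MeasureTheory

namespace PearsonComponents

/-! ### Geometry of interchanging two unit vectors. -/

section SwapUnitVectors

variable {E : Type*} [NormedAddCommGroup E] [InnerProductSpace ℝ E]

/-- The map `y ↦ y - ⟪y, a⟫ (1 / (1 - ⟪b, a⟫)) (a - b)`. For unit vectors `a ≠ b` it agrees on the
hyperplane orthogonal to `b` with the reflection that interchanges `a` and `b`. -/
noncomputable def swapMap (a b y : E) : E :=
  y - (⟪y, a⟫ * (1 / (1 - ⟪b, a⟫))) • (a - b)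

/-- The equality case of Cauchy–Schwarz. -/
lemma inner_ne_one_of_ne {a b : E} (ha : ‖a‖ = 1) (hb : ‖b‖ = 1) (hab : a ≠ b) :
    1 - ⟪b, a⟫ ≠ 0 := fun h =>
  hab ((inner_eq_one_iff_of_norm_eq_one (𝕜 := ℝ) hb ha).1 (by linarith)).symm

lemma inner_swapMap_self {a b y : E} (ha : ‖a‖ = 1) (hab : 1 - ⟪b, a⟫ ≠ 0) :
    ⟪swapMap a b y, a⟫ = 0 := by
  rw [swapMap, inner_sub_left, real_inner_smul_left, inner_sub_left, real_inner_self_eq_norm_sq, ha]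
  field_simp
  ring

/-- On the hyperplane `⟪swapMap a b y, b⟫ = ⟪y, a⟫`, so the second map adds back the multiple of `a
- b` removed by the first. -/
lemma swapMap_swapMap {a b y : E} (hb : ‖b‖ = 1) (hab : 1 - ⟪b, a⟫ ≠ 0)
    (hy : ⟪y, b⟫ = 0) : swapMap b a (swapMap a b y) = y := by
  have h1 : ⟪swapMap a b y, b⟫ = ⟪y, a⟫ := by
    rw [swapMap, inner_sub_left, real_inner_smul_left, inner_sub_left, real_inner_self_eq_norm_sq,
      hb, hy, real_inner_comm b a]
    field_simp
    ring
  rw [swapMap, h1, swapMap, real_inner_comm b a]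
  module

lemma bijOn_swapMap {a b : E} (ha : ‖a‖ = 1) (hb : ‖b‖ = 1) (hab : a ≠ b) :
    Set.BijOn (swapMap a b) {y | ⟪y, b⟫ = 0} {z | ⟪z, a⟫ = 0} := by
  have h1 := inner_ne_one_of_ne ha hb hab
  have h2 := inner_ne_one_of_ne hb ha hab.symm
  exact Set.InvOn.bijOn (f' := swapMap b a)
    ⟨fun y hy => swapMap_swapMap hb h1 hy, fun z hz => swapMap_swapMap ha h2 hz⟩
    (fun y _ => inner_swapMap_self ha h1) (fun z _ => inner_swapMap_self hb h2)

/-- The adjoint of `swapMap a b`. -/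
noncomputable def swapMapAdjoint (a b t : E) : E :=
  t - (⟪a - b, t⟫ * (1 / (1 - ⟪b, a⟫))) • a

lemma inner_swapMap (a b y t : E) : ⟪swapMap a b y, t⟫ = ⟪y, swapMapAdjoint a b t⟫ := by
  rw [swapMap, swapMapAdjoint, inner_sub_left, inner_sub_right, real_inner_smul_left,
    real_inner_smul_right]
  ring

/-- For unit vectors, both sides are squared lengths of projections, onto `b^⊥` and `a^⊥`; they
agree because `swapMap a b` is isometric from `b^⊥` to `a^⊥`. This removes `p` from the limiting
variance. -/
lemma norm_sq_swapMapAdjoint_sub {a b : E} (ha : ‖a‖ = 1) (hab : 1 - ⟪b, a⟫ ≠ 0)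
    (t : E) : ‖swapMapAdjoint a b t‖ ^ 2 - ⟪b, swapMapAdjoint a b t⟫ ^ 2 =
      ‖t‖ ^ 2 - ⟪a, t⟫ ^ 2 := by
  rw [← real_inner_self_eq_norm_sq, swapMapAdjoint, inner_sub_left, inner_sub_right,
    inner_sub_right, inner_sub_right, real_inner_smul_left, real_inner_smul_right,
    real_inner_smul_left, real_inner_smul_right, real_inner_smul_right, inner_sub_left,
    real_inner_self_eq_norm_sq, real_inner_self_eq_norm_sq, ha, real_inner_comm a t]
  field_simp
  ring

lemma norm_sq_sub_inner_smul {a : E} (ha : ‖a‖ = 1) (t : E) :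
    ‖t - ⟪t, a⟫ • a‖ ^ 2 = ‖t‖ ^ 2 - ⟪a, t⟫ ^ 2 := by
  rw [norm_sub_sq_real, real_inner_smul_right, norm_smul, ha, mul_one,
    Real.norm_eq_abs, sq_abs, real_inner_comm a t]
  ring

end SwapUnitVectors

/-! ### The vectors `r` and `√p`, and projections of `Y_n` as sums of scores. -/

variable {m : ℕ}

lemma centre_eq (x : EuclideanSpace ℝ (Fin m)) : x - ⟪x, diag m⟫ • diag m = centre x := by
  have h : diag m = (1 / √(m : ℝ)) • ones m := by
    ext i; simp [diag, ones]
  rw [centre, h, real_inner_smul_right, smul_smul]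
  congr 2
  have : (1 / √(m : ℝ)) * (1 / √(m : ℝ)) = 1 / m := by
    rw [div_mul_div_comm, Real.mul_self_sqrt (Nat.cast_nonneg m), one_mul]
  rw [← this]
  ring

lemma inner_centre_left (x t : EuclideanSpace ℝ (Fin m)) :
    ⟪centre x, t⟫ = ⟪x, centre t⟫ := by
  rw [← centre_eq, ← centre_eq, inner_sub_left, inner_sub_right, real_inner_smul_left,
    real_inner_smul_right, real_inner_comm t (diag m)]
  ring

lemma continuous_centre : Continuous (centre (m := m)) := by
  unfold centre
  fun_prop

lemma norm_diag (hm : m ≠ 0) : ‖diag m‖ = 1 := by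
  have : (m : ℝ) ≠ 0 := Nat.cast_ne_zero.2 hm
  rw [← sq_eq_sq₀ (norm_nonneg _) zero_le_one, EuclideanSpace.real_norm_sq_eq]
  simp [diag, this]

lemma IsAdmissible.ne_zero {p : Fin m → ℝ} (hp : IsAdmissible p) : m ≠ 0 := by
  rintro rfl
  simpa using hp.sum_eq_one

lemma IsAdmissible.norm_sqrtVec {p : Fin m → ℝ} (hp : IsAdmissible p) : ‖sqrtVec p‖ = 1 := by
  rw [← sq_eq_sq₀ (norm_nonneg _) zero_le_one, EuclideanSpace.real_norm_sq_eq]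
  simp [sqrtVec, Real.sq_sqrt (hp.pos _).le, hp.sum_eq_one]

lemma IsAdmissible.diag_ne_sqrtVec {p : Fin m → ℝ} (hp : IsAdmissible p) :
    diag m ≠ sqrtVec p := by
  obtain ⟨i, hi⟩ := hp.not_uniform
  intro h
  apply hi
  have h1 : 1 / √(m : ℝ) = √(p i) := congrArg (fun v : EuclideanSpace ℝ (Fin m) => v i) h
  rw [← Real.sq_sqrt (hp.pos i).le, ← h1, div_pow, Real.sq_sqrt (Nat.cast_nonneg m), one_pow]

lemma continuous_transform (p : Fin m → ℝ) : Continuous (transform p) := by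
  unfold transform
  fun_prop

/-- The score `j ↦ uⱼ / √pⱼ - ⟪√p, u⟫`, whose sums over a sample give the projections of `Y_n`. -/
noncomputable def score (p : Fin m → ℝ) (u : EuclideanSpace ℝ (Fin m)) (j : Fin m) : ℝ :=
  u j / √(p j) - ⟪sqrtVec p, u⟫

lemma inner_sqrtVec (p : Fin m → ℝ) (u : EuclideanSpace ℝ (Fin m)) :
    ⟪sqrtVec p, u⟫ = ∑ i, √(p i) * u i := by
  simp [PiLp.inner_apply, sqrtVec, mul_comm]

lemma freq_eq_sum {Ω : Type*} (ξ : ℕ → Ω → Fin m) (n : ℕ) (ω : Ω) (i : Fin m) :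
    (freq ξ n ω i : ℝ) = ∑ k ∈ Finset.range n, if ξ k ω = i then 1 else 0 := by
  rw [freq, Finset.sum_boole]

/-- For `n = 0` both sides are `0`, since division by zero gives zero. -/
lemma IsAdmissible.inner_Y {p : Fin m → ℝ} (hp : IsAdmissible p) {Ω : Type*}
    (ξ : ℕ → Ω → Fin m) (n : ℕ) (ω : Ω) (u : EuclideanSpace ℝ (Fin m)) :
    ⟪Y p ξ n ω, u⟫ = (√n)⁻¹ * ∑ k ∈ Finset.range n, score p u (ξ k ω) := by
  have hs : ∀ i, √(p i) ≠ 0 := fun i => (Real.sqrt_pos.2 (hp.pos i)).ne'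
  have h1 : ∑ k ∈ Finset.range n, score p u (ξ k ω)
      = ∑ i, (freq ξ n ω i - n * p i) / √(p i) * u i := by
    simp only [score, Finset.sum_sub_distrib, Finset.sum_const, Finset.card_range, nsmul_eq_mul,
      sub_div, sub_mul, inner_sqrtVec, Finset.mul_sum]
    congr 1
    · simp only [freq_eq_sum, Finset.sum_div, Finset.sum_mul]
      rw [Finset.sum_comm]
      refine Finset.sum_congr rfl fun k _ => ?_
      -- Observation `k` contributes only to its own cell.
      rw [Finset.sum_eq_single (ξ k ω)]
      · simp; ring
      · intro i _ hi
        simp [hi.symm]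
      · simp
    · refine Finset.sum_congr rfl fun i _ => ?_
      rw [mul_div_assoc, Real.div_sqrt, mul_assoc]
  rw [h1, Finset.mul_sum, PiLp.inner_apply]
  refine Finset.sum_congr rfl fun i _ => ?_
  simp only [Y, Real.sqrt_mul (Nat.cast_nonneg n), RCLike.inner_apply, conj_trivial]
  rw [div_mul_eq_div_div_swap]
  ring

lemma IsAdmissible.inner_Y_sqrtVec {p : Fin m → ℝ} (hp : IsAdmissible p) {Ω : Type*}
    (ξ : ℕ → Ω → Fin m) (n : ℕ) (ω : Ω) : ⟪Y p ξ n ω, sqrtVec p⟫ = 0 := by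
  have hs : ∀ i, √(p i) ≠ 0 := fun i => (Real.sqrt_pos.2 (hp.pos i)).ne'
  have h : ∀ j, score p (sqrtVec p) j = 0 := fun j => by
    rw [score, real_inner_self_eq_norm_sq, hp.norm_sqrtVec]
    simp [sqrtVec, hs j]
  simp [hp.inner_Y, h]

lemma IsAdmissible.sum_mul_score {p : Fin m → ℝ} (hp : IsAdmissible p)
    (u : EuclideanSpace ℝ (Fin m)) : ∑ j, p j * score p u j = 0 := by
  have h : ∀ j, p j * score p u j = √(p j) * u j - p j * ⟪sqrtVec p, u⟫ := fun j => by
    rw [score, mul_sub, ← mul_div_assoc, mul_comm (p j), mul_div_assoc, Real.div_sqrt, mul_comm]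
  simp only [h, Finset.sum_sub_distrib, ← inner_sqrtVec, ← Finset.sum_mul, hp.sum_eq_one, one_mul,
    sub_self]

lemma IsAdmissible.sum_mul_score_sq {p : Fin m → ℝ} (hp : IsAdmissible p)
    (u : EuclideanSpace ℝ (Fin m)) :
    ∑ j, p j * score p u j ^ 2 = ‖u‖ ^ 2 - ⟪sqrtVec p, u⟫ ^ 2 := by
  have h : ∀ j, p j * score p u j ^ 2
      = u j ^ 2 - 2 * ⟪sqrtVec p, u⟫ * (√(p j) * u j) + p j * ⟪sqrtVec p, u⟫ ^ 2 := fun j => by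
    have hs : √(p j) ≠ 0 := (Real.sqrt_pos.2 (hp.pos j)).ne'
    have hp' : p j = √(p j) ^ 2 := (Real.sq_sqrt (hp.pos j).le).symm
    rw [score]
    generalize ⟪sqrtVec p, u⟫ = c
    rw [hp', Real.sqrt_sq (Real.sqrt_nonneg _)]
    field_simp
    ring
  simp only [h, Finset.sum_add_distrib, Finset.sum_sub_distrib, ← Finset.mul_sum, ← inner_sqrtVec,
    ← Finset.sum_mul, hp.sum_eq_one, EuclideanSpace.real_norm_sq_eq]
  ring

/-- The Cramér–Wold device: it reduces the vector limit to real-valued projections. -/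
lemma charFun_map_eq_charFun_map_inner {Ω E : Type*} [MeasurableSpace Ω] {P : Measure Ω}
    [NormedAddCommGroup E] [InnerProductSpace ℝ E]
    [MeasurableSpace E] [BorelSpace E] {V : Ω → E}
    (hV : AEMeasurable V P) (t : E) :
    charFun (P.map V) t = charFun (P.map fun ω => ⟪V ω, t⟫) 1 := by
  have h : AEMeasurable (fun ω => ⟪V ω, t⟫) P :=
    (continuous_id.inner continuous_const).measurable.comp_aemeasurable hV
  rw [charFun_apply, charFun_apply,
    integral_map hV (Continuous.aestronglyMeasurable (by fun_prop)),
    integral_map h (Continuous.aestronglyMeasurable (by fun_prop))]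
  simp

lemma IsSample.measurable_Y {p : Fin m → ℝ} {Ω : Type*} [MeasurableSpace Ω] {P : Measure Ω}
    {ξ : ℕ → Ω → Fin m} (h : IsSample P p ξ) (n : ℕ) : Measurable (Y p ξ n) := by
  refine (WithLp.measurable_toLp 2 _).comp (measurable_pi_lambda _ fun i => ?_)
  simp only [freq_eq_sum]
  refine ((Finset.measurable_sum _ fun k _ => ?_).sub_const _).div_const _
  exact (measurable_of_finite fun j : Fin m => if j = i then (1 : ℝ) else 0).comp (h.measurable k)

/-! ### Central limit theorem for the scores. -/

section Sample

variable {p : Fin m → ℝ} {Ω : Type*} [MeasurableSpace Ω] {P : Measure Ω} [IsProbabilityMeasure P]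
  {ξ : ℕ → Ω → Fin m}

lemma IsSample.integral_comp (h : IsSample P p ξ) (k : ℕ) (f : Fin m → ℝ) :
    ∫ ω, f (ξ k ω) ∂P = ∑ j, p j * f j := by
  have := Measure.isProbabilityMeasure_map (μ := P) (h.measurable k).aemeasurable
  rw [← integral_map (f := f) (h.measurable k).aemeasurable (by fun_prop),
    integral_fintype (.of_finite)]
  refine Finset.sum_congr rfl fun j _ => ?_
  rw [map_measureReal_apply (h.measurable k) (measurableSet_singleton j), smul_eq_mul, ← h.law k j]
  rfl

lemma IsSample.identDistrib (h : IsSample P p ξ) (k : ℕ) : IdentDistrib (ξ k) (ξ 0) P P where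
  aemeasurable_fst := (h.measurable k).aemeasurable
  aemeasurable_snd := (h.measurable 0).aemeasurable
  map_eq := by
    refine Measure.ext_of_singleton fun j => ?_
    rw [Measure.map_apply (h.measurable k) (measurableSet_singleton j),
      Measure.map_apply (h.measurable 0) (measurableSet_singleton j)]
    exact (measureReal_eq_measureReal_iff).1 ((h.law k j).trans (h.law 0 j).symm)

lemma IsSample.tendstoInDistribution_score (h : IsSample P p ξ) (hp : IsAdmissible p)
    (u : EuclideanSpace ℝ (Fin m)) :
    TendstoInDistribution (fun (n : ℕ) ω => (√n)⁻¹ * ∑ k ∈ Finset.range n, score p u (ξ k ω)) atTop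
      id (fun _ => P) (gaussianReal 0 (‖u‖ ^ 2 - ⟪sqrtVec p, u⟫ ^ 2).toNNReal) := by
  have hmean : ∫ ω, score p u (ξ 0 ω) ∂P = 0 := by
    rw [h.integral_comp 0 (score p u), hp.sum_mul_score]
  have hmeas : ∀ k, Measurable fun ω => score p u (ξ k ω) := fun k =>
    (measurable_of_finite (score p u)).comp (h.measurable k)
  have hvar : Var[fun ω => score p u (ξ 0 ω); P] = ‖u‖ ^ 2 - ⟪sqrtVec p, u⟫ ^ 2 := by
    rw [variance_of_integral_eq_zero (hmeas 0).aemeasurable hmean, ← hp.sum_mul_score_sq]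
    exact h.integral_comp 0 fun j => score p u j ^ 2
  have hclt := tendstoInDistribution_inv_sqrt_mul_sum_sub
    (P' := gaussianReal 0 (‖u‖ ^ 2 - ⟪sqrtVec p, u⟫ ^ 2).toNNReal) (Y := id) (P := P)
    (X := fun k ω => score p u (ξ k ω)) (by rw [hvar]; exact .id)
    -- The score takes finitely many values, so the sum of their absolute values bounds it.
    (MemLp.of_bound (hmeas 0).aestronglyMeasurable (∑ j, ‖score p u j‖) (.of_forall fun ω =>
      Finset.single_le_sum (f := fun j => ‖score p u j‖) (fun _ _ => norm_nonneg _)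
        (Finset.mem_univ _)))
    (h.indep.comp (fun _ => score p u) fun _ => measurable_of_finite _)
    (fun k => (h.identDistrib k).comp (measurable_of_finite (score p u)))
  simpa only [hmean, mul_zero, sub_zero] using hclt

end Sample

/-! ### The Gaussian limit and convergence of `Z_n`. -/

section Gaussian

variable {Ω' : Type*} [MeasurableSpace Ω'] {P' : Measure Ω'}
  {X : Ω' → EuclideanSpace ℝ (Fin m)}

lemma hasLaw_stdGaussian_of_iIndepFun [IsProbabilityMeasure P']
    (hX_law : ∀ i, HasLaw (fun ω => X ω i) (gaussianReal 0 1) P')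
    (hX_indep : iIndepFun (fun (i : Fin m) (ω : Ω') => X ω i) P') :
    HasLaw X (stdGaussian (EuclideanSpace ℝ (Fin m))) P' := by
  have hpi : AEMeasurable (fun ω i => X ω i) P' :=
    aemeasurable_pi_lambda _ fun i => (hX_law i).aemeasurable
  have hX : X = WithLp.toLp 2 ∘ fun ω i => X ω i := rfl
  refine ⟨(WithLp.measurable_toLp 2 _).comp_aemeasurable hpi, ?_⟩
  rw [hX, ← AEMeasurable.map_map_of_aemeasurable (WithLp.measurable_toLp 2 _).aemeasurable hpi,
    (iIndepFun_iff_map_fun_eq_pi_map fun i => (hX_law i).aemeasurable).1 hX_indep,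
    ← map_pi_eq_stdGaussian]
  simp only [(hX_law _).map_eq]

lemma charFun_map_centre (hX : HasLaw X (stdGaussian (EuclideanSpace ℝ (Fin m))) P')
    (t : EuclideanSpace ℝ (Fin m)) :
    charFun (P'.map fun ω => centre (X ω)) t = Complex.exp (-‖centre t‖ ^ 2 / 2) := by
  rw [charFun_map_eq_charFun_map_inner (V := fun ω => centre (X ω))
    (continuous_centre.measurable.comp_aemeasurable hX.aemeasurable)]
  simp only [inner_centre_left]
  rw [← charFun_map_eq_charFun_map_inner hX.aemeasurable, hX.map_eq, charFun_stdGaussian]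

theorem tendstoInDistribution_Z [IsProbabilityMeasure P']
    (hX : HasLaw X (stdGaussian (EuclideanSpace ℝ (Fin m))) P')
    {p : Fin m → ℝ} (hp : IsAdmissible p) {Ω : Type*} [MeasurableSpace Ω] {P : Measure Ω}
    [IsProbabilityMeasure P] {ξ : ℕ → Ω → Fin m} (hξ : IsSample P p ξ) :
    TendstoInDistribution (Z p ξ) atTop (fun ω => centre (X ω)) (fun _ => P) P' where
  forall_aemeasurable n :=
    ((continuous_transform p).measurable.comp (hξ.measurable_Y n)).aemeasurable
  aemeasurable_limit := continuous_centre.measurable.comp_aemeasurable hX.aemeasurable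
  tendsto := by
    have hZ : ∀ n, AEMeasurable (Z p ξ n) P := fun n =>
      ((continuous_transform p).measurable.comp (hξ.measurable_Y n)).aemeasurable
    refine ProbabilityMeasure.tendsto_iff_tendsto_charFun.2 fun t => ?_
    have hd := norm_diag hp.ne_zero
    have hab := inner_ne_one_of_ne hd hp.norm_sqrtVec hp.diag_ne_sqrtVec
    have hclt := ProbabilityMeasure.tendsto_iff_tendsto_charFun.1
      (hξ.tendstoInDistribution_score hp (swapMapAdjoint (diag m) (sqrtVec p) t)).tendsto 1
    -- The variance becomes `‖centre t‖²`.
    simp only [ProbabilityMeasure.coe_mk, ← hp.inner_Y, norm_sq_swapMapAdjoint_sub hd hab,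
      ← norm_sq_sub_inner_smul hd, centre_eq, Measure.map_id, charFun_gaussianReal,
      Real.coe_toNNReal _ (sq_nonneg _)] at hclt
    simp only [← inner_swapMap] at hclt
    simp only [ProbabilityMeasure.coe_mk, charFun_map_centre hX,
      charFun_map_eq_charFun_map_inner (hZ _)]
    convert hclt using 2
    congr 1
    push_cast
    ring_nf

end Gaussian

end PearsonComponents

theorem mainTheorem2 (m : ℕ)
    {Ω' : Type*} [MeasurableSpace Ω'] (P' : Measure Ω') [IsProbabilityMeasure P']
    (X : Ω' → EuclideanSpace ℝ (Fin m))
    (hX_law : ∀ i, HasLaw (fun ω => X ω i) (gaussianReal 0 1) P')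
    (hX_indep : iIndepFun (fun (i : Fin m) (ω : Ω') => X ω i) P') :
    -- the two expressions of the limit vector agree
    (∀ ω, X ω - ⟪X ω, PearsonComponents.diag m⟫ • PearsonComponents.diag m
      = PearsonComponents.centre (X ω)) ∧
    -- convergence in distribution of `Z_n`
    (∀ p : Fin m → ℝ, PearsonComponents.IsAdmissible p →
      ∀ (Ω : Type u) [MeasurableSpace Ω] (P : Measure Ω) [IsProbabilityMeasure P]
        (ξ : ℕ → Ω → Fin m), PearsonComponents.IsSample P p ξ →
        TendstoInDistribution (PearsonComponents.Z p ξ) atTop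
          (fun ω => PearsonComponents.centre (X ω)) (fun _ => P) P') ∧
    -- statistics based on `Z_n`
    (∀ (F : Type*) [PseudoMetricSpace F] [MeasurableSpace F] [BorelSpace F]
      (S : EuclideanSpace ℝ (Fin m) → F), Measurable S →
      (∀ᵐ ω ∂P', ContinuousAt S (PearsonComponents.centre (X ω))) →
        (∀ p : Fin m → ℝ, PearsonComponents.IsAdmissible p →
          ∀ (Ω : Type u) [MeasurableSpace Ω] (P : Measure Ω) [IsProbabilityMeasure P]
            (ξ : ℕ → Ω → Fin m), PearsonComponents.IsSample P p ξ →
            TendstoInDistribution (fun n ω => S (PearsonComponents.Z p ξ n ω)) atTop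
              (fun ω => S (PearsonComponents.centre (X ω))) (fun _ => P) P') ∧
        PearsonComponents.AsymptoticallyDistributionFree.{u} S) ∧
    -- `Y_n` takes its values in the hyperplane orthogonal to `√p`, and the transformation of `Y_n`
    -- to `Z_n` maps that hyperplane one-to-one onto the hyperplane orthogonal to `r`
    (∀ p : Fin m → ℝ, PearsonComponents.IsAdmissible p →
      (∀ (Ω : Type u) (ξ : ℕ → Ω → Fin m) (n : ℕ) (ω : Ω), 1 ≤ n →
        ⟪PearsonComponents.Y p ξ n ω, PearsonComponents.sqrtVec p⟫ = 0) ∧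
      Set.BijOn (PearsonComponents.transform p)
        {y | ⟪y, PearsonComponents.sqrtVec p⟫ = 0}
        {z | ⟪z, PearsonComponents.diag m⟫ = 0}) := by
  have hX := PearsonComponents.hasLaw_stdGaussian_of_iIndepFun hX_law hX_indep
  refine ⟨fun ω => PearsonComponents.centre_eq (X ω), fun p hp Ω _ P _ ξ hξ =>
    PearsonComponents.tendstoInDistribution_Z hX hp hξ, fun F _ _ _ S hS hc => ?_,
    fun p hp => ⟨fun Ω ξ n ω _ => hp.inner_Y_sqrtVec ξ n ω,
      PearsonComponents.bijOn_swapMap (PearsonComponents.norm_diag hp.ne_zero) hp.norm_sqrtVec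
        hp.diag_ne_sqrtVec⟩⟩
  have hlim : ∀ p : Fin m → ℝ, PearsonComponents.IsAdmissible p →
      ∀ (Ω : Type u) [MeasurableSpace Ω] (P : Measure Ω) [IsProbabilityMeasure P]
        (ξ : ℕ → Ω → Fin m), PearsonComponents.IsSample P p ξ →
        TendstoInDistribution (fun n ω => S (PearsonComponents.Z p ξ n ω)) atTop
          (fun ω => S (PearsonComponents.centre (X ω))) (fun _ => P) P' :=
    fun p hp Ω _ P _ ξ hξ =>
      (PearsonComponents.tendstoInDistribution_Z hX hp hξ).comp_of_ae_continuousAt hS hc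
  have hSX : AEMeasurable (fun ω => S (PearsonComponents.centre (X ω))) P' :=
    hS.comp_aemeasurable
      (PearsonComponents.continuous_centre.measurable.comp_aemeasurable hX.aemeasurable)
  have := Measure.isProbabilityMeasure_map hSX
  -- The common limit law is that of `S (centre X)`, which does not involve `p`.
  refine ⟨hlim, P'.map fun ω => S (PearsonComponents.centre (X ω)),
    this, fun p hp Ω _ P _ ξ hξ => ?_⟩
  have h := hlim p hp Ω P ξ hξ
  exact ⟨h.forall_aemeasurable, aemeasurable_id, by simpa only [Measure.map_id'] using h.tendsto⟩
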